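/- **Setting.** Let $\mathcal G_d=(\mathcal V,\mathcal E)$ be a finite strongly connected digraph without self-loops; $(v_j,v_i)\in\mathcal E$ denotes the edge from $v_i$ to $v_j$, and $\mathcal N_j^-$, $\mathcal N_j^+$ are the sets of in- and out-neighbours of $v_j$. Each edge has real limits $0<l_{ji}\le u_{ji}$. Assume the *Integer Circulation Conditions*: $\lceil l_{ji}\rceil\le\lfloor u_{ji}\rfloor$ for every edge, and for every $S\subseteq\mathcal V$ $$\sum_{(v_j,v_i)\in\mathcal E,\ v_j\in S,\ v_i\notin S}\lceil l_{ji}\rceil\ \le\ \sum_{(v_l,v_j)\in\mathcal E,\ v_j\in S,\ v_l\notin S}\lfloor u_{lj}\rfloor .$$ **Algorithm 8.** Every edge $(v_j,v_i)$ carries an actual integer weight $f_{ji}[k]$, kept by its tail $v_i$, and a perceived weight $f^{(p)}_{ji}[k]$, kept by its head $v_j$; $f_{ji}[0]=f^{(p)}_{ji}[0]=\lceil l_{ji}\rceil$. Every node $v_j$ fixes an arbitrary cyclic order of its incoming and outgoing edges, starting with the first one. For $k=0,1,2,\dots$ all nodes $v_j$ simultaneously do the following. 1. Compute the perceived imbalance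 $x_j^{(p)}[k]=\sum_{v_i\in\mathcal N_j^-}f^{(p)}_{ji}[k]-\sum_{v_l\in\mathcal N_j^+}f_{lj}[k]$. 2. If $x_j^{(p)}[k]>0$: go through the edges in the cyclic order, resuming with the edge after the last one tried on an earlier occasion; in the local copies of the weights add $1$ on each outgoing edge $(v_l,v_j)$ that is below $\lfloor u_{lj}\rfloor$, subtract $1$ on each incoming edge $(v_j,v_i)$ that is above $\lceil l_{ji}\rceil$, and skip the other edges, until the local imbalance is $0$. The resulting weights $f^{(j)}_{ji}[k]$, $f^{(j)}_{lj}[k]$ are the desired ones. If $x^{(p)}_j[k]\le 0$, put $f^{(j)}_{ji}[k]=f^{(p)}_{ji}[k]$ and $f^{(j)}_{lj}[k]=f_{lj}[k]$. 3. Send $f^{(j)}_{ji}[k]$ to each in-neighbour $v_i$, and receive $f^{(l)}_{lj}[k]$ from each out-neighbour $v_l$ (replaced by $f_{lj}[k]$ if the packet is dropped). Put $f_{lj}[k+1]=f^{(l)}_{lj}[k]+f^{(j)}_{lj}[k]-f_{lj}[k]$. 4. Send $f_{lj}[k+1]$ to each out-neighbour $v_l$, and receive $f^{(p)}_{ji}[k+1]=f_{ji}[k+1]$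 from each in-neighbour $v_i$; if the packet is dropped, put $f^{(p)}_{ji}[k+1]=f^{(j)}_{ji}[k]$. **Packet drops.** The packets of Step 3 (resp. Step 4) of iteration $k$ are sent at time step $s_k$ (resp. $t_k$), where $s_k,t_k\in\mathbb N$ and $s_k\le t_k<s_{k+1}$. For every ordered pair $(j,i)$ such that $(v_j,v_i)\in\mathcal E$ or $(v_i,v_j)\in\mathcal E$, the transmission from $v_i$ to $v_j$ at a given time step is dropped with probability $q_{ji}\in[0,1)$; drops at different time steps, or for different ordered pairs $(j,i)$, are mutually independent. **Claim.** Almost surely there is a (random) $k_0$ such that for all $k\ge k_0$: $f_{ji}[k]=f_{ji}[k_0]$ and $l_{ji}\le f_{ji}[k]\le u_{ji}$ for every edge $(v_j,v_i)\in\mathcal E$; and, for every node $v_j$, the imbalance $x_j[k]=\sum_{v_i\in\mathcal N_j^-}f_{ji}[k]-\sum_{v_l\in\mathcal N_j^+}f_{lj}[k]$ is $0$ and the perceived in-weight is correct, $\sum_{v_i\in\mathcal N_j^-}f^{(p)}_{ji}[k]=\sum_{v_i\in\mathcal N_j^-}f_{ji}[k]$. -/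

import Mathlib

namespace WeightBalancing

open MeasureTheory ProbabilityTheory

variable {V : Type*}

/-- Every node can be reached from every node along directed edges. -/
def StronglyConnected (G : Digraph V) : Prop :=
  ∀ i j : V, Relation.ReflTransGen G.Adj i j

/-- The edges of `G`, as pairs (tail, head): the pair `(i, j)` is the edge from `i` to `j`. -/
abbrev Edge (G : Digraph V) : Type _ := {p : V × V // G.Adj p.1 p.2}

variable {G : Digraph V}

/-- The node that an edge leaves; it is in charge of the weight of the edge. -/
abbrev Edge.tail (e : Edge G) : V := e.1.1

/-- The node that an edge enters. -/
abbrev Edge.head (e : Edge G) : V := e.1.2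

/-- The edges that enter or leave the node `j`. -/
def incident (G : Digraph V) (j : V) : Set (Edge G) := {e | e.head = j ∨ e.tail = j}

section Graph

variable [Fintype V] [DecidableEq V] [DecidableRel G.Adj]

/-- Sum of the values of `w` on the edges that enter `j`. -/
def inWeight (w : Edge G → ℤ) (j : V) : ℤ := ∑ e : Edge G with e.head = j, w e

/-- Sum of the values of `w` on the edges that leave `j`. -/
def outWeight (w : Edge G → ℤ) (j : V) : ℤ := ∑ e : Edge G with e.tail = j, w e

/-- In-weight minus out-weight of `j`. -/
def imbalance (w : Edge G → ℤ) (j : V) : ℤ := inWeight w j - outWeight w j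

variable (G) in
/-- In-degree plus out-degree of `j`. -/
def totalDegree (j : V) : ℕ :=
  Fintype.card {e : Edge G // e.head = j} + Fintype.card {e : Edge G // e.tail = j}

/-- `ord j` numbers the edges that enter or leave `j` by `0, …, totalDegree j - 1`, without
repetition (its values on other edges are never used). -/
def IsEdgeOrder (ord : V → Edge G → ℕ) : Prop :=
  ∀ j : V, Set.BijOn (ord j) (incident G j) (Set.Iio (totalDegree G j))

/-- Each interval `[l e, u e]` contains an integer, and for each set `S` of nodes, the least
possible integer weight entering `S` is at most the greatest possible integer weight
leaving `S`. -/
structure IntegerCirculationConditions (l u : Edge G → ℝ) : Prop where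
  interval : ∀ e, ⌈l e⌉ ≤ ⌊u e⌋
  cut : ∀ S : Finset V,
    ∑ e : Edge G with e.head ∈ S ∧ e.tail ∉ S, ⌈l e⌉ ≤
      ∑ e : Edge G with e.tail ∈ S ∧ e.head ∉ S, ⌊u e⌋

end Graph

noncomputable section Algorithm

variable [Fintype V] [DecidableEq V] [DecidableRel G.Adj]

/-- The memory of all the nodes at the start of an iteration. -/
structure State (G : Digraph V) where
  /-- actual weight `f e`, known to the tail of `e` -/
  weight : Edge G → ℤ
  /-- perceived weight, known to the head of `e` -/
  perceived : Edge G → ℤ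
  /-- for each node, the number of the incident edge that it tries next -/
  next : V → ℕ

/-- The weights as node `j` knows them: perceived ones on its incoming edges, actual ones on its
outgoing edges. -/
def State.view (σ : State G) (j : V) (e : Edge G) : ℤ :=
  if e.head = j then σ.perceived e else σ.weight e

/-- The perceived weight imbalance of `j`. -/
def State.perceivedImbalance (σ : State G) (j : V) : ℤ :=
  inWeight σ.perceived j - outWeight σ.weight j

/-- Node `j` with local weights `s.1` tries the incident edge number `s.2`: it adds `1` if this is
an outgoing edge below its maximum, subtracts `1` if this is an incoming edge above its minimum,
and does not change the weight otherwise. Then it moves on to the next edge in cyclic order. -/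
def tryEdge (l u : Edge G → ℝ) (ord : V → Edge G → ℕ) (j : V) (s : (Edge G → ℤ) × ℕ) :
    (Edge G → ℤ) × ℕ :=
  (fun e =>
      if ord j e = s.2 then
        if e.tail = j ∧ s.1 e < ⌊u e⌋ then s.1 e + 1
        else if e.head = j ∧ ⌈l e⌉ < s.1 e then s.1 e - 1
        else s.1 e
      else s.1 e,
    (s.2 + 1) % totalDegree G j)

open Classical in
/-- Node `j` tries one edge after the other until the imbalance of its local weights is zero for
the first time. (Should this never happen, nothing is changed; the integer circulation conditions
rule this out.) -/
def balanceLocally (l u : Edge G → ℝ) (ord : V → Edge G → ℕ) (j : V) (s : (Edge G → ℤ) × ℕ) :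
    (Edge G → ℤ) × ℕ :=
  if h : ∃ n : ℕ, imbalance ((tryEdge l u ord j)^[n] s).1 j = 0 then
    (tryEdge l u ord j)^[Nat.find h] s
  else s

/-- The outcome of the selection of desirable weights by node `j`: its desired weights of its
incoming and outgoing edges, and its next edge number. A node whose perceived imbalance is not
positive keeps everything. -/
def select (l u : Edge G → ℝ) (ord : V → Edge G → ℕ) (σ : State G) (j : V) :
    (Edge G → ℤ) × ℕ :=
  if 0 < σ.perceivedImbalance j then balanceLocally l u ord j (σ.view j, σ.next j)
  else (σ.view j, σ.next j)

/-- The weight desired by node `j` for the edge `e`. -/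
def desired (l u : Edge G → ℝ) (ord : V → Edge G → ℕ) (σ : State G) (j : V) (e : Edge G) : ℤ :=
  (select l u ord σ j).1 e

/-- The new weight of `e`, computed by its tail; `back e` says whether the weight desired by the
head of `e` has reached the tail of `e`. -/
def newWeight (l u : Edge G → ℝ) (ord : V → Edge G → ℕ) (back : Edge G → Bool) (σ : State G)
    (e : Edge G) : ℤ :=
  (if back e then desired l u ord σ e.head e else σ.weight e)
    + desired l u ord σ e.tail e - σ.weight e

/-- One iteration. `back e` says whether the desired weight sent by the head of `e` has reached
the tail, and `forth e` whether the new weight sent by the tail of `e` has reached the head. -/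
def iteration (l u : Edge G → ℝ) (ord : V → Edge G → ℕ) (back forth : Edge G → Bool)
    (σ : State G) : State G where
  weight := newWeight l u ord back σ
  perceived e :=
    if forth e then newWeight l u ord back σ e else desired l u ord σ e.head e
  next j := (select l u ord σ j).2

/-- Initially all actual and perceived weights are the rounded up lower limits, and each node
starts with its edge number `0`. -/
def initialState (l : Edge G → ℝ) : State G where
  weight e := ⌈l e⌉
  perceived e := ⌈l e⌉
  next _ := 0

/-- The state at the start of iteration `k`. Here `x τ j i = true` means that at time step `τ` the
link from node `i` to node `j` works. In iteration `k`, the desired weights travel (from heads to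
tails) at time step `s k` and the new weights (from tails to heads) at time step `t k`. -/
def run (l u : Edge G → ℝ) (ord : V → Edge G → ℕ) (s t : ℕ → ℕ) (x : ℕ → V → V → Bool) :
    ℕ → State G
  | 0 => initialState l
  | k + 1 =>
      iteration l u ord (fun e => x (s k) e.tail e.head) (fun e => x (t k) e.head e.tail)
        (run l u ord s t x k)

end Algorithm

/-- The communication links: the ordered pairs (receiver, sender) of nodes joined by an edge of
`G` in one of the two directions. -/
abbrev Link (G : Digraph V) : Type _ := {p : V × V // G.Adj p.1 p.2 ∨ G.Adj p.2 p.1}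

/-- Packet drops: at each time step, the link from `i` to `j` fails with probability
`q j i`, independently of all other time steps, links and directions. -/
structure IsPacketDropModel (G : Digraph V) (q : V → V → ℝ)
    {Ω : Type*} [MeasurableSpace Ω] (P : Measure Ω) (x : ℕ → V → V → Ω → Bool) : Prop where
  measurable : ∀ (τ : ℕ) (c : Link G), Measurable (x τ c.1.1 c.1.2)
  prob : ∀ (τ : ℕ) (c : Link G), P.real {ω | x τ c.1.1 c.1.2 ω = false} = q c.1.1 c.1.2
  indep : iIndepFun (fun (p : ℕ × Link G) => x p.1 p.2.1.1 p.2.1.2) P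

end WeightBalancing

namespace WeightBalancing

set_option linter.unusedSectionVars false

open MeasureTheory ProbabilityTheory Filter

variable {V : Type*} [Fintype V] [DecidableEq V] {G : Digraph V} [DecidableRel G.Adj]
  {l u : Edge G → ℝ} {ord : V → Edge G → ℕ}

/-! Read `weight e - perceived e` as the number of tokens travelling on `e`. It stays nonnegative,
and the weights stay within the integer limits, whatever packets are lost (`State.Valid.iteration`).
The potential is `totalDeficit`, the sum of the negative parts of the perceived imbalances. No
iteration raises it, since drops only delay tokens (`deficit_iteration_le`). The perceived
imbalances sum to minus the number of travelling tokens, so at deficit zero they all vanish and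
nothing travels: such a state is balanced, hence a fixed point.

A positive deficit falls after finitely many iterations without drops
(`exists_totalDeficit_iterate_lt`). Otherwise let `S` be the set of nodes that are positive
infinitely often. Outside `S` everything eventually freezes. The cyclic order makes nodes of `S` try
every boundary edge again, so these edges are saturated: incoming ones at the minimum, outgoing ones
at the maximum. The cut condition for `S` then forces all imbalances to vanish.

There are finitely many valid states, so one number `K` of iterations suffices for all of them. By
the second Borel–Cantelli lemma, blocks of `K + 1` iterations without drops almost surely recur, and
the deficit descends to zero. -/

/-- The number of tokens that node `j` can still push over the edge `e`: additions on an outgoing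
edge, subtractions on an incoming one. -/
noncomputable def residual (l u : Edge G → ℝ) (j : V) (w : Edge G → ℤ) (e : Edge G) : ℤ :=
  if e.tail = j then ⌊u e⌋ - w e else if e.head = j then w e - ⌈l e⌉ else 0

/-- The integer weights that respect the limits. -/
def Feasible (l u : Edge G → ℝ) (w : Edge G → ℤ) : Prop :=
  ∀ e, ⌈l e⌉ ≤ w e ∧ w e ≤ ⌊u e⌋

theorem Feasible.residual_nonneg {w : Edge G → ℤ} (hw : Feasible l u w) (j : V) (e : Edge G) :
    0 ≤ residual l u j w e := by
  have := hw e
  unfold residual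
  split_ifs <;> omega

theorem head_ne_tail (hloop : ∀ v, ¬ G.Adj v v) (e : Edge G) : e.head ≠ e.tail := by
  intro h
  have := e.2
  rw [← show e.1.2 = e.1.1 from h] at this
  exact hloop _ this

/-- The correction term does not depend on `w`, and the cut condition for `{j}` makes it
nonpositive. Questions about imbalance thus become questions about residuals, where both edge
directions look alike. -/
theorem imbalance_eq_sum_residual (hloop : ∀ v, ¬ G.Adj v v) (w : Edge G → ℤ) (j : V) :
    imbalance w j = ∑ e, residual l u j w e +
      (∑ e : Edge G with e.head = j, ⌈l e⌉ - ∑ e : Edge G with e.tail = j, ⌊u e⌋) := by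
  unfold imbalance inWeight outWeight
  simp only [Finset.sum_filter]
  rw [← Finset.sum_sub_distrib, ← Finset.sum_sub_distrib, ← Finset.sum_add_distrib]
  refine Finset.sum_congr rfl fun e _ => ?_
  have := head_ne_tail hloop e
  unfold residual
  by_cases h1 : e.head = j <;> by_cases h2 : e.tail = j
  · exact absurd (h1.trans h2.symm) this
  all_goals simp [h1, h2] <;> ring

theorem sum_lower_le_sum_upper (hloop : ∀ v, ¬ G.Adj v v)
    (hcirc : IntegerCirculationConditions l u) (j : V) :
    ∑ e : Edge G with e.head = j, ⌈l e⌉ ≤ ∑ e : Edge G with e.tail = j, ⌊u e⌋ := by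
  have h := hcirc.cut {j}
  have h1 : ∀ e : Edge G, (e.head ∈ ({j} : Finset V) ∧ e.tail ∉ ({j} : Finset V)) ↔ e.head = j := by
    intro e
    have := head_ne_tail hloop e
    simp only [Finset.mem_singleton]
    exact ⟨fun h => h.1, fun h => ⟨h, fun h' => this (h.trans h'.symm)⟩⟩
  have h2 : ∀ e : Edge G, (e.tail ∈ ({j} : Finset V) ∧ e.head ∉ ({j} : Finset V)) ↔ e.tail = j := by
    intro e
    have := head_ne_tail hloop e
    simp only [Finset.mem_singleton]
    exact ⟨fun h => h.1, fun h => ⟨h, fun h' => this (h'.trans h.symm)⟩⟩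
  simpa only [h1, h2] using h

theorem mem_incident_of_residual_pos {j : V} {w : Edge G → ℤ} {e : Edge G}
    (he : 0 < residual l u j w e) : e ∈ incident G j := by
  unfold residual at he
  unfold incident
  split_ifs at he with h1 h2
  · exact Or.inr h1
  · exact Or.inl h2
  · omega

/-! ### A single try -/

theorem residual_tryEdge (hloop : ∀ v, ¬ G.Adj v v) {s : (Edge G → ℤ) × ℕ}
    (hs : Feasible l u s.1) (j : V) (e : Edge G) :
    residual l u j (tryEdge l u ord j s).1 e =
      if ord j e = s.2 ∧ 0 < residual l u j s.1 e then residual l u j s.1 e - 1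
      else residual l u j s.1 e := by
  have := head_ne_tail hloop e
  have := hs e
  unfold residual tryEdge
  by_cases h1 : e.head = j <;> by_cases h2 : e.tail = j
  · exact absurd (h1.trans h2.symm) ‹_›
  all_goals simp only [h1, h2, if_true, if_false, true_and, false_and]
  all_goals split_ifs <;> omega

theorem residual_tryEdge_le (hloop : ∀ v, ¬ G.Adj v v) {s : (Edge G → ℤ) × ℕ}
    (hs : Feasible l u s.1) (j : V) (e : Edge G) :
    residual l u j (tryEdge l u ord j s).1 e ≤ residual l u j s.1 e := by
  rw [residual_tryEdge hloop hs]
  split_ifs <;> omega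

theorem Feasible.tryEdge {s : (Edge G → ℤ) × ℕ}
    (hs : Feasible l u s.1) (j : V) : Feasible l u (tryEdge l u ord j s).1 := by
  intro e
  have := hs e
  unfold WeightBalancing.tryEdge
  dsimp only
  split_ifs <;> omega

/-- Edges with positive residual are incident to `j`, where `ord j` is injective, so at most one of
them carries the number being tried. -/
theorem sum_residual_le_tryEdge (hloop : ∀ v, ¬ G.Adj v v) (hord : IsEdgeOrder ord)
    {s : (Edge G → ℤ) × ℕ} (hs : Feasible l u s.1) (j : V) :
    ∑ e, residual l u j s.1 e ≤ ∑ e, residual l u j (tryEdge l u ord j s).1 e + 1 := by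
  have hcard : ((Finset.univ.filter fun e : Edge G =>
      ord j e = s.2 ∧ 0 < residual l u j s.1 e).card : ℤ) ≤ 1 := by
    norm_cast
    refine Finset.card_le_one.2 fun a ha b hb => ?_
    simp only [Finset.mem_filter, Finset.mem_univ, true_and] at ha hb
    exact (hord j).injOn (mem_incident_of_residual_pos ha.2)
      (mem_incident_of_residual_pos hb.2) (ha.1.trans hb.1.symm)
  have hsum : ∑ e, residual l u j s.1 e = ∑ e, residual l u j (tryEdge l u ord j s).1 e +
      ((Finset.univ.filter fun e : Edge G =>
        ord j e = s.2 ∧ 0 < residual l u j s.1 e).card : ℤ) := by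
    rw [Finset.card_filter]
    push_cast
    rw [← Finset.sum_add_distrib]
    refine Finset.sum_congr rfl fun e _ => ?_
    rw [residual_tryEdge hloop hs]
    split_ifs <;> simp
  omega

/-! ### Repeated tries -/

theorem Feasible.iterate_tryEdge {s : (Edge G → ℤ) × ℕ}
    (hs : Feasible l u s.1) (j : V) (n : ℕ) :
    Feasible l u ((WeightBalancing.tryEdge l u ord j)^[n] s).1 := by
  induction n with
  | zero => exact hs
  | succ n ih => rw [Function.iterate_succ_apply']; exact ih.tryEdge j

theorem residual_iterate_antitone (hloop : ∀ v, ¬ G.Adj v v) {s : (Edge G → ℤ) × ℕ}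
    (hs : Feasible l u s.1) (j : V) (e : Edge G) :
    Antitone fun n => residual l u j ((tryEdge l u ord j)^[n] s).1 e := by
  refine antitone_nat_of_succ_le fun n => ?_
  rw [Function.iterate_succ_apply']
  exact residual_tryEdge_le hloop (hs.iterate_tryEdge j n) j e

theorem iterate_tryEdge_snd_lt {s : (Edge G → ℤ) × ℕ} {j : V} (hs : s.2 < totalDegree G j)
    (n : ℕ) : ((tryEdge l u ord j)^[n] s).2 < totalDegree G j := by
  induction n with
  | zero => exact hs
  | succ n ih =>
    rw [Function.iterate_succ_apply']
    exact Nat.mod_lt _ (by omega)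

/-- The number of steps from position `n` to position `o` in a cycle of length `D`. -/
def cyclicDist (D o n : ℕ) : ℕ := if n ≤ o then o - n else o + D - n

/-- At `o = n` this fails: the distance jumps from `0` to `D - 1`. -/
theorem cyclicDist_succ {D o n : ℕ} (ho : o < D) (hn : n < D) (hne : o ≠ n) :
    cyclicDist D o ((n + 1) % D) + 1 = cyclicDist D o n := by
  unfold cyclicDist
  rcases Nat.lt_or_ge (n + 1) D with h | h
  · rw [Nat.mod_eq_of_lt h]
    split_ifs <;> omega
  · have : n + 1 = D := by omega
    rw [this, Nat.mod_self]
    split_ifs <;> omega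

/-- Used to bound `m`: only as many tries as the initial distance can avoid position `o`. -/
theorem cyclicDist_iterate {s : (Edge G → ℤ) × ℕ} {j : V} {o : ℕ} (ho : o < totalDegree G j)
    (hs : s.2 < totalDegree G j) (m : ℕ)
    (hm : ∀ i < m, o ≠ ((tryEdge l u ord j)^[i] s).2) :
    cyclicDist (totalDegree G j) o ((tryEdge l u ord j)^[m] s).2 + m =
      cyclicDist (totalDegree G j) o s.2 := by
  induction m with
  | zero => rfl
  | succ m ih =>
    rw [← ih fun i hi => hm i (by omega), Function.iterate_succ_apply',
      ← cyclicDist_succ ho (iterate_tryEdge_snd_lt hs m) (hm m (by omega))]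
    simp only [tryEdge]
    omega

/-- The try at step `i` either lowers a positive residual or finds it already zero, hence already
below its initial value. -/
theorem residual_iterate_lt (hloop : ∀ v, ¬ G.Adj v v) {s : (Edge G → ℤ) × ℕ}
    (hs : Feasible l u s.1) {j : V} {e : Edge G} (he : 0 < residual l u j s.1 e) {i m : ℕ}
    (him : i < m) (hi : ord j e = ((tryEdge l u ord j)^[i] s).2) :
    residual l u j ((tryEdge l u ord j)^[m] s).1 e < residual l u j s.1 e := by
  have h1 := residual_iterate_antitone (ord := ord) hloop hs j e (Nat.zero_le i)
  have h2 := residual_iterate_antitone (ord := ord) hloop hs j e (Nat.succ_le_of_lt him)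
  have h3 := residual_tryEdge (ord := ord) hloop (hs.iterate_tryEdge (ord := ord) j i) j e
  simp only [Function.iterate_succ_apply', Function.iterate_zero, id] at h1 h2
  rw [h3] at h2
  split_ifs at h2 <;> grind

theorem exists_residual_pos (hloop : ∀ v, ¬ G.Adj v v)
    (hcirc : IntegerCirculationConditions l u) {w : Edge G → ℤ} {j : V}
    (hw : 0 < imbalance w j) : ∃ e, 0 < residual l u j w e := by
  by_contra! h
  rw [imbalance_eq_sum_residual (l := l) (u := u) hloop] at hw
  have := sum_lower_le_sum_upper hloop hcirc j
  have := Finset.sum_nonpos fun e (_ : e ∈ Finset.univ) => h e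
  omega

theorem exists_imbalance_iterate_lt (hloop : ∀ v, ¬ G.Adj v v)
    (hcirc : IntegerCirculationConditions l u) (hord : IsEdgeOrder ord)
    {s : (Edge G → ℤ) × ℕ} (hs : Feasible l u s.1) {j : V} (hj : s.2 < totalDegree G j)
    (hpos : 0 < imbalance s.1 j) :
    ∃ m, imbalance ((tryEdge l u ord j)^[m] s).1 j < imbalance s.1 j := by
  obtain ⟨e, he⟩ := exists_residual_pos hloop hcirc hpos
  have ho : ord j e < totalDegree G j := (hord j).mapsTo (mem_incident_of_residual_pos he)
  -- The distance counts the tries before `e` is reached; the extra one is the try of `e` itself.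
  set M := cyclicDist (totalDegree G j) (ord j e) s.2 + 1 with hM
  refine ⟨M, ?_⟩
  have : ∃ i < M, ord j e = ((tryEdge l u ord j)^[i] s).2 := by
    by_contra! h
    have := cyclicDist_iterate ho hj M h
    omega
  obtain ⟨i, hi, hi'⟩ := this
  rw [imbalance_eq_sum_residual (l := l) (u := u) hloop,
    imbalance_eq_sum_residual (l := l) (u := u) hloop s.1]
  have := Finset.sum_lt_sum (s := Finset.univ)
    (fun e _ => residual_iterate_antitone (ord := ord) hloop hs j e (Nat.zero_le M))
    ⟨e, Finset.mem_univ e, residual_iterate_lt hloop hs he hi hi'⟩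
  simp only [Function.iterate_zero, id] at this
  omega

theorem imbalance_le_tryEdge (hloop : ∀ v, ¬ G.Adj v v) (hord : IsEdgeOrder ord)
    {s : (Edge G → ℤ) × ℕ} (hs : Feasible l u s.1) (j : V) :
    imbalance s.1 j ≤ imbalance (tryEdge l u ord j s).1 j + 1 := by
  rw [imbalance_eq_sum_residual (l := l) (u := u) hloop,
    imbalance_eq_sum_residual (l := l) (u := u) hloop (tryEdge l u ord j s).1]
  have := sum_residual_le_tryEdge hloop hord hs j
  omega

/-- A positive imbalance must eventually fall, and a single try lowers it by at most one, so it
cannot jump over zero. -/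
theorem exists_imbalance_eq_zero (hloop : ∀ v, ¬ G.Adj v v)
    (hcirc : IntegerCirculationConditions l u) (hord : IsEdgeOrder ord)
    {s : (Edge G → ℤ) × ℕ} (hs : Feasible l u s.1) {j : V} (hj : s.2 < totalDegree G j)
    (hpos : 0 < imbalance s.1 j) :
    ∃ m, imbalance ((tryEdge l u ord j)^[m] s).1 j = 0 := by
  by_contra! h
  have hp : ∀ m, 0 < imbalance ((tryEdge l u ord j)^[m] s).1 j := by
    intro m
    induction m with
    | zero => exact hpos
    | succ m ih =>
      have h1 := imbalance_le_tryEdge hloop hord (hs.iterate_tryEdge (ord := ord) j m) j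
      have h2 := h (m + 1)
      rw [Function.iterate_succ_apply'] at h2 ⊢
      omega
  have hdesc : ∀ b : ℕ, ∀ m, imbalance ((tryEdge l u ord j)^[m] s).1 j ≠ b := by
    intro b
    induction b using Nat.strong_induction_on with
    | _ b ih =>
      intro m hb
      obtain ⟨m', hm'⟩ := exists_imbalance_iterate_lt hloop hcirc hord
        (hs.iterate_tryEdge (ord := ord) j m) (iterate_tryEdge_snd_lt hj m) (hp m)
      rw [← Function.iterate_add_apply] at hm'
      have := hp (m' + m)
      exact ih (imbalance ((tryEdge l u ord j)^[m' + m] s).1 j).toNat (by omega) (m' + m)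
        (by omega)
  exact hdesc (imbalance s.1 j).toNat 0 (by simp; omega)

/-! ### Invariant of the states -/

/-- The states that the algorithm can be in. The difference between the actual and the perceived
weight of an edge counts the tokens that are on their way to its head. -/
structure State.Valid (l u : Edge G → ℝ) (σ : State G) : Prop where
  lower : ∀ e, ⌈l e⌉ ≤ σ.perceived e
  perceived_le : ∀ e, σ.perceived e ≤ σ.weight e
  upper : ∀ e, σ.weight e ≤ ⌊u e⌋
  next_lt : ∀ j, σ.next j < max 1 (totalDegree G j)

theorem State.Valid.feasible_view {σ : State G} (hσ : σ.Valid l u) (j : V) :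
    Feasible l u (σ.view j) := by
  intro e
  have := hσ.lower e
  have := hσ.perceived_le e
  have := hσ.upper e
  unfold State.view
  split_ifs <;> omega

theorem imbalance_view (hloop : ∀ v, ¬ G.Adj v v) (σ : State G) (j : V) :
    imbalance (σ.view j) j = σ.perceivedImbalance j := by
  unfold imbalance State.perceivedImbalance inWeight outWeight
  congr 1
  · refine Finset.sum_congr rfl fun e he => ?_
    simp [State.view, (Finset.mem_filter.1 he).2]
  · refine Finset.sum_congr rfl fun e he => ?_
    have := head_ne_tail hloop e
    rw [(Finset.mem_filter.1 he).2] at this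
    simp [State.view, this]

/-! ### The selection of desired weights -/

/-- Only a node without edges needs the `max 1` of `State.Valid`; positive imbalance forces an
incident edge. -/
theorem State.Valid.next_lt_totalDegree (hloop : ∀ v, ¬ G.Adj v v)
    (hcirc : IntegerCirculationConditions l u) (hord : IsEdgeOrder ord)
    {σ : State G} (hσ : σ.Valid l u) {j : V} (hj : 0 < σ.perceivedImbalance j) :
    σ.next j < totalDegree G j := by
  rw [← imbalance_view hloop] at hj
  obtain ⟨e, he⟩ := exists_residual_pos hloop hcirc hj
  have h1 : ord j e < totalDegree G j := (hord j).mapsTo (mem_incident_of_residual_pos he)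
  have h2 := hσ.next_lt j
  omega

theorem select_of_nonpos {σ : State G} {j : V} (hj : σ.perceivedImbalance j ≤ 0) :
    select l u ord σ j = (σ.view j, σ.next j) := by
  simp [select, not_lt.2 hj]

theorem select_of_pos (hloop : ∀ v, ¬ G.Adj v v)
    (hcirc : IntegerCirculationConditions l u) (hord : IsEdgeOrder ord)
    {σ : State G} (hσ : σ.Valid l u) {j : V} (hj : 0 < σ.perceivedImbalance j) :
    ∃ m, 0 < m ∧ select l u ord σ j = (tryEdge l u ord j)^[m] (σ.view j, σ.next j) ∧
      imbalance (select l u ord σ j).1 j = 0 := by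
  classical
  have hex := exists_imbalance_eq_zero (s := (σ.view j, σ.next j)) hloop hcirc hord
    (hσ.feasible_view j) (hσ.next_lt_totalDegree hloop hcirc hord hj)
    ((imbalance_view hloop σ j).symm ▸ hj)
  have hsel : select l u ord σ j = (tryEdge l u ord j)^[Nat.find hex] (σ.view j, σ.next j) := by
    rw [select, if_pos hj, balanceLocally, dif_pos hex]
  have h0 := Nat.find_spec hex
  refine ⟨Nat.find hex, ?_, hsel, hsel ▸ h0⟩
  rw [Nat.find_pos]
  change ¬ imbalance (σ.view j) j = 0
  rw [imbalance_view hloop]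
  omega

theorem exists_select_eq_iterate (hloop : ∀ v, ¬ G.Adj v v)
    (hcirc : IntegerCirculationConditions l u) (hord : IsEdgeOrder ord)
    {σ : State G} (hσ : σ.Valid l u) (j : V) :
    ∃ m, select l u ord σ j = (tryEdge l u ord j)^[m] (σ.view j, σ.next j) := by
  rcases lt_or_ge 0 (σ.perceivedImbalance j) with h | h
  · obtain ⟨m, -, hm, -⟩ := select_of_pos hloop hcirc hord hσ h
    exact ⟨m, hm⟩
  · exact ⟨0, select_of_nonpos h⟩

theorem residual_select_le (hloop : ∀ v, ¬ G.Adj v v)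
    (hcirc : IntegerCirculationConditions l u) (hord : IsEdgeOrder ord)
    {σ : State G} (hσ : σ.Valid l u) (j : V) (e : Edge G) :
    residual l u j (select l u ord σ j).1 e ≤ residual l u j (σ.view j) e := by
  obtain ⟨m, hm⟩ := exists_select_eq_iterate hloop hcirc hord hσ j
  rw [hm]
  exact residual_iterate_antitone (ord := ord) hloop (s := (σ.view j, σ.next j))
    (hσ.feasible_view j) j e (Nat.zero_le m)

theorem feasible_select (hloop : ∀ v, ¬ G.Adj v v)
    (hcirc : IntegerCirculationConditions l u) (hord : IsEdgeOrder ord)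
    {σ : State G} (hσ : σ.Valid l u) (j : V) : Feasible l u (select l u ord σ j).1 := by
  obtain ⟨m, hm⟩ := exists_select_eq_iterate hloop hcirc hord hσ j
  rw [hm]
  exact Feasible.iterate_tryEdge (s := (σ.view j, σ.next j)) (hσ.feasible_view j) j m

theorem desired_tail (hloop : ∀ v, ¬ G.Adj v v)
    (hcirc : IntegerCirculationConditions l u) (hord : IsEdgeOrder ord)
    {σ : State G} (hσ : σ.Valid l u) (e : Edge G) :
    σ.weight e ≤ desired l u ord σ e.tail e ∧ desired l u ord σ e.tail e ≤ ⌊u e⌋ := by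
  refine ⟨?_, (feasible_select hloop hcirc hord hσ e.tail e).2⟩
  have h := residual_select_le hloop hcirc hord hσ e.tail e
  simp only [residual, if_true, State.view, if_neg (head_ne_tail hloop e)] at h
  unfold desired
  omega

theorem desired_head (hloop : ∀ v, ¬ G.Adj v v)
    (hcirc : IntegerCirculationConditions l u) (hord : IsEdgeOrder ord)
    {σ : State G} (hσ : σ.Valid l u) (e : Edge G) :
    ⌈l e⌉ ≤ desired l u ord σ e.head e ∧ desired l u ord σ e.head e ≤ σ.perceived e := by
  refine ⟨(feasible_select hloop hcirc hord hσ e.head e).1, ?_⟩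
  have h := residual_select_le hloop hcirc hord hσ e.head e
  simp only [residual, if_true, State.view, if_neg (head_ne_tail hloop e).symm] at h
  unfold desired
  omega

/-- An unchanged positive residual means that `e` was not tried, while at least one try took place;
so the pointer moved strictly closer to `e`. -/
theorem cyclicDist_select_lt (hloop : ∀ v, ¬ G.Adj v v)
    (hcirc : IntegerCirculationConditions l u) (hord : IsEdgeOrder ord)
    {σ : State G} (hσ : σ.Valid l u) {j : V} {e : Edge G}
    (he : 0 < residual l u j (σ.view j) e) (hj : 0 < σ.perceivedImbalance j)
    (hsel : residual l u j (select l u ord σ j).1 e = residual l u j (σ.view j) e) :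
    cyclicDist (totalDegree G j) (ord j e) (select l u ord σ j).2 <
      cyclicDist (totalDegree G j) (ord j e) (σ.next j) := by
  obtain ⟨m, hm0, hm, -⟩ := select_of_pos hloop hcirc hord hσ hj
  rw [hm] at hsel ⊢
  have h := cyclicDist_iterate (l := l) (u := u) (ord := ord) (s := (σ.view j, σ.next j))
    ((hord j).mapsTo (mem_incident_of_residual_pos he))
    (hσ.next_lt_totalDegree hloop hcirc hord hj) m fun i hi hi' =>
      (residual_iterate_lt (s := (σ.view j, σ.next j)) hloop (hσ.feasible_view j) he hi hi').ne hsel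
  dsimp only at h
  omega

/-! ### One iteration -/

theorem State.Valid.iteration (hloop : ∀ v, ¬ G.Adj v v)
    (hcirc : IntegerCirculationConditions l u) (hord : IsEdgeOrder ord)
    {σ : State G} (hσ : σ.Valid l u) (back forth : Edge G → Bool) :
    (iteration l u ord back forth σ).Valid l u := by
  -- The head only lowers its perceived weight, the tail only raises the actual one, and perceived
  -- is at most actual; so both bounds hold whether or not the head's packet arrives.
  have key : ∀ e, desired l u ord σ e.head e ≤ newWeight l u ord back σ e ∧
      newWeight l u ord back σ e ≤ desired l u ord σ e.tail e := by
    intro e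
    have h1 := desired_tail hloop hcirc hord hσ e
    have h2 := desired_head hloop hcirc hord hσ e
    have h3 := hσ.perceived_le e
    unfold newWeight
    split_ifs <;> omega
  refine ⟨fun e => ?_, fun e => ?_, fun e => ?_, fun j => ?_⟩
  · have := desired_head hloop hcirc hord hσ e
    have := key e
    simp only [WeightBalancing.iteration]
    split_ifs <;> omega
  · have := key e
    simp only [WeightBalancing.iteration]
    split_ifs <;> omega
  · have := desired_tail hloop hcirc hord hσ e
    have := key e
    simp only [WeightBalancing.iteration]
    omega
  · simp only [WeightBalancing.iteration]
    rcases lt_or_ge 0 (σ.perceivedImbalance j) with h | h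
    · obtain ⟨m, -, hm, -⟩ := select_of_pos hloop hcirc hord hσ h
      rw [hm]
      have := iterate_tryEdge_snd_lt (l := l) (u := u) (ord := ord) (s := (σ.view j, σ.next j))
        (hσ.next_lt_totalDegree hloop hcirc hord h) m
      omega
    · rw [select_of_nonpos h]
      exact hσ.next_lt j

/-- The other endpoint can only send further tokens in over incoming edges or take tokens back from
outgoing ones. A lost packet merely withholds this help. -/
theorem imbalance_select_le (hloop : ∀ v, ¬ G.Adj v v)
    (hcirc : IntegerCirculationConditions l u) (hord : IsEdgeOrder ord)
    {σ : State G} (hσ : σ.Valid l u) (back forth : Edge G → Bool) (j : V) :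
    imbalance (select l u ord σ j).1 j ≤
      (iteration l u ord back forth σ).perceivedImbalance j := by
  unfold imbalance State.perceivedImbalance inWeight outWeight
  refine sub_le_sub (Finset.sum_le_sum fun e he => ?_) (Finset.sum_le_sum fun e he => ?_)
  · obtain rfl := (Finset.mem_filter.1 he).2
    have h1 := desired_tail hloop hcirc hord hσ e
    have h2 := desired_head hloop hcirc hord hσ e
    have h3 := hσ.perceived_le e
    change desired l u ord σ e.head e ≤ _
    simp only [WeightBalancing.iteration, newWeight]
    split_ifs <;> omega
  · obtain rfl := (Finset.mem_filter.1 he).2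
    have h1 := desired_tail hloop hcirc hord hσ e
    have h2 := desired_head hloop hcirc hord hσ e
    have h3 := hσ.perceived_le e
    change _ ≤ desired l u ord σ e.tail e
    simp only [WeightBalancing.iteration, newWeight]
    split_ifs <;> omega

/-! ### The deficit as potential function -/

/-- The number of tokens that node `j` can still absorb. -/
def State.deficit (σ : State G) (j : V) : ℕ := (-σ.perceivedImbalance j).toNat

/-- The number of tokens that all the nodes can still absorb. -/
def State.totalDeficit (σ : State G) : ℕ := ∑ j, σ.deficit j

/-- A positive node aims at imbalance zero, any other node at its present imbalance; neither ends
below its aim. -/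
theorem deficit_iteration_le (hloop : ∀ v, ¬ G.Adj v v)
    (hcirc : IntegerCirculationConditions l u) (hord : IsEdgeOrder ord)
    {σ : State G} (hσ : σ.Valid l u) (back forth : Edge G → Bool) (j : V) :
    (iteration l u ord back forth σ).deficit j ≤ σ.deficit j := by
  have h := imbalance_select_le hloop hcirc hord hσ back forth j
  unfold State.deficit
  rcases lt_or_ge 0 (σ.perceivedImbalance j) with hj | hj
  · obtain ⟨m, -, -, h0⟩ := select_of_pos hloop hcirc hord hσ hj
    omega
  · rw [select_of_nonpos hj, imbalance_view hloop] at h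
    omega

theorem totalDeficit_iteration_le (hloop : ∀ v, ¬ G.Adj v v)
    (hcirc : IntegerCirculationConditions l u) (hord : IsEdgeOrder ord)
    {σ : State G} (hσ : σ.Valid l u) (back forth : Edge G → Bool) :
    (iteration l u ord back forth σ).totalDeficit ≤ σ.totalDeficit :=
  Finset.sum_le_sum fun j _ => deficit_iteration_le hloop hcirc hord hσ back forth j

/-- Each edge is counted once at its head, as perceived, and once at its tail, as actual. -/
theorem sum_perceivedImbalance (σ : State G) :
    ∑ j, σ.perceivedImbalance j = ∑ e, (σ.perceived e - σ.weight e) := by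
  unfold State.perceivedImbalance inWeight outWeight
  rw [Finset.sum_sub_distrib, Finset.sum_sub_distrib]
  congr 1 <;> exact Finset.sum_fiberwise _ _ _

/-- The states in which every node is balanced and every perceived weight is correct. -/
def State.Balanced (σ : State G) : Prop :=
  σ.perceived = σ.weight ∧ ∀ j, imbalance σ.weight j = 0

theorem State.Valid.balanced_of_totalDeficit_eq_zero {σ : State G} (hσ : σ.Valid l u)
    (h0 : σ.totalDeficit = 0) : σ.Balanced := by
  have hnn : ∀ j ∈ Finset.univ, 0 ≤ σ.perceivedImbalance j := by
    intro j hj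
    have := (Finset.sum_eq_zero_iff.1 h0) j hj
    unfold State.deficit at this
    omega
  have hnp : ∀ e ∈ Finset.univ, σ.perceived e - σ.weight e ≤ 0 := fun e _ =>
    sub_nonpos.2 (hσ.perceived_le e)
  have hsum := sum_perceivedImbalance σ
  have h1 := Finset.sum_nonneg hnn
  have h2 := Finset.sum_nonpos hnp
  have h3 : σ.perceived = σ.weight := by
    funext e
    have := (Finset.sum_eq_zero_iff_of_nonpos hnp).1 (by omega) e (Finset.mem_univ e)
    omega
  refine ⟨h3, fun j => ?_⟩
  have := (Finset.sum_eq_zero_iff_of_nonneg hnn).1 (by omega) j (Finset.mem_univ j)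
  rwa [State.perceivedImbalance, h3] at this

theorem State.Balanced.iteration {σ : State G} (hσ : σ.Balanced) (back forth : Edge G → Bool) :
    iteration l u ord back forth σ = σ := by
  have hsel : ∀ j, select l u ord σ j = (σ.view j, σ.next j) := by
    intro j
    refine select_of_nonpos ?_
    rw [State.perceivedImbalance, hσ.1]
    exact (hσ.2 j).le
  have hview : ∀ j, σ.view j = σ.weight := by
    intro j
    funext e
    simp [State.view, hσ.1]
  have hnew : newWeight l u ord back σ = σ.weight := by
    funext e
    simp [newWeight, desired, hsel, hview]
  obtain ⟨w, p, n⟩ := σ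
  have hp : p = w := hσ.1
  simp only [WeightBalancing.iteration, hnew, desired, hsel, hview]
  simp [hp]

/-! ### Iterations without packet drops -/

/-- One iteration without packet drops. -/
noncomputable def cleanIteration (l u : Edge G → ℝ) (ord : V → Edge G → ℕ) (σ : State G) :
    State G :=
  iteration l u ord (fun _ => true) (fun _ => true) σ

theorem cleanIteration_weight (σ : State G) (e : Edge G) :
    (cleanIteration l u ord σ).weight e =
      desired l u ord σ e.head e + desired l u ord σ e.tail e - σ.weight e := by
  simp [cleanIteration, iteration, newWeight]

theorem cleanIteration_perceived (σ : State G) :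
    (cleanIteration l u ord σ).perceived = (cleanIteration l u ord σ).weight := by
  funext e
  simp [cleanIteration, iteration]

theorem perceivedImbalance_eq_imbalance {σ : State G} (h : σ.perceived = σ.weight) (j : V) :
    σ.perceivedImbalance j = imbalance σ.weight j := by
  rw [State.perceivedImbalance, h, imbalance]

theorem desired_of_nonpos {σ : State G} (hp : σ.perceived = σ.weight) {j : V}
    (hj : σ.perceivedImbalance j ≤ 0) (e : Edge G) : desired l u ord σ j e = σ.weight e := by
  rw [desired, select_of_nonpos hj]
  simp [State.view, hp]

/-- At a nonpositive node incoming weights cannot fall and outgoing weights cannot rise. An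
unchanged imbalance therefore leaves no room for any change, nor for a desire of the neighbour to
change. -/
theorem desired_of_perceivedImbalance_eq (hloop : ∀ v, ¬ G.Adj v v)
    (hcirc : IntegerCirculationConditions l u) (hord : IsEdgeOrder ord)
    {σ : State G} (hσ : σ.Valid l u) (hp : σ.perceived = σ.weight) {j : V}
    (hj : σ.perceivedImbalance j ≤ 0)
    (hj' : (cleanIteration l u ord σ).perceivedImbalance j = σ.perceivedImbalance j)
    {e : Edge G} (he : e ∈ incident G j) :
    desired l u ord σ e.head e = σ.weight e ∧ desired l u ord σ e.tail e = σ.weight e := by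
  have hin : ∀ e ∈ Finset.univ.filter (fun e : Edge G => e.head = j),
      σ.weight e ≤ (cleanIteration l u ord σ).weight e := by
    intro e he
    have h1 : desired l u ord σ e.head e = σ.weight e := by
      rw [(Finset.mem_filter.1 he).2, desired_of_nonpos hp hj]
    have h2 := desired_tail hloop hcirc hord hσ e
    rw [cleanIteration_weight]
    omega
  have hout : ∀ e ∈ Finset.univ.filter (fun e : Edge G => e.tail = j),
      (cleanIteration l u ord σ).weight e ≤ σ.weight e := by
    intro e he
    have h1 : desired l u ord σ e.tail e = σ.weight e := by
      rw [(Finset.mem_filter.1 he).2, desired_of_nonpos hp hj]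
    have h2 := desired_head hloop hcirc hord hσ e
    rw [cleanIteration_weight, ← hp]
    rw [← hp] at h1
    omega
  rw [perceivedImbalance_eq_imbalance hp,
    perceivedImbalance_eq_imbalance (cleanIteration_perceived σ)] at hj'
  have h1 := Finset.sum_le_sum hin
  have h2 := Finset.sum_le_sum hout
  unfold imbalance inWeight outWeight at hj'
  rcases he with he | he
  · have h3 := (Finset.sum_eq_sum_iff_of_le hin).1 (by omega) e (by simp [he])
    have h4 : desired l u ord σ e.head e = σ.weight e := by rw [he, desired_of_nonpos hp hj]
    rw [cleanIteration_weight] at h3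
    omega
  · have h3 := (Finset.sum_eq_sum_iff_of_le hout).1 (by omega) e (by simp [he])
    have h4 : desired l u ord σ e.tail e = σ.weight e := by rw [he, desired_of_nonpos hp hj]
    rw [cleanIteration_weight] at h3
    omega

theorem sum_imbalance_eq_cut (w : Edge G → ℤ) (S : Finset V) :
    ∑ j ∈ S, imbalance w j = ∑ e : Edge G with e.head ∈ S ∧ e.tail ∉ S, w e -
      ∑ e : Edge G with e.tail ∈ S ∧ e.head ∉ S, w e := by
  unfold imbalance inWeight outWeight
  simp only [Finset.sum_filter, Finset.sum_sub_distrib]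
  rw [Finset.sum_comm, Finset.sum_comm (s := S)]
  simp only [Finset.sum_ite_eq]
  rw [← Finset.sum_sub_distrib, ← Finset.sum_sub_distrib]
  refine Finset.sum_congr rfl fun e _ => ?_
  by_cases h1 : e.head ∈ S <;> by_cases h2 : e.tail ∈ S <;> simp [h1, h2]

theorem not_frequently_lt_of_eventually_le {d : ℕ → ℕ} {T : ℕ}
    (hd : ∀ n ≥ T, d (n + 1) ≤ d n) : ¬ ∃ᶠ n in atTop, d (n + 1) < d n := by
  intro hf
  have hle : ∀ n ≥ T, ∀ m ≥ n, d m ≤ d n := by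
    intro n hn m hm
    induction m, hm using Nat.le_induction with
    | base => exact le_rfl
    | succ m hm ih => exact (hd m (by omega)).trans ih
  have : ∀ b n, T ≤ n → d n ≠ b := by
    intro b
    induction b using Nat.strong_induction_on with
    | _ b ih =>
      intro n hn hb
      obtain ⟨m, hm, hlt⟩ := (frequently_atTop.1 hf) n
      have := hle n hn m hm
      exact ih (d (m + 1)) (by omega) (m + 1) (by omega) rfl
  exact this _ T le_rfl rfl

theorem desired_of_incident {σ : State G} {w : ℤ} {j : V} {e : Edge G} (he : e ∈ incident G j)
    (h : desired l u ord σ e.head e = w ∧ desired l u ord σ e.tail e = w) :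
    desired l u ord σ j e = w := by
  rcases he with rfl | rfl
  · exact h.1
  · exact h.2

/-- If the deficit never fell, each node's own deficit would be constant, because none of them can
rise. -/
theorem exists_totalDeficit_iterate_lt (hloop : ∀ v, ¬ G.Adj v v)
    (hcirc : IntegerCirculationConditions l u) (hord : IsEdgeOrder ord)
    {σ : State G} (hσ : σ.Valid l u) (h0 : σ.totalDeficit ≠ 0) :
    ∃ n, ((cleanIteration l u ord)^[n] σ).totalDeficit < σ.totalDeficit := by
  classical
  by_contra! hcon
  have hvalid : ∀ n, ((cleanIteration l u ord)^[n] σ).Valid l u := by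
    intro n
    induction n with
    | zero => exact hσ
    | succ n ih =>
      rw [Function.iterate_succ_apply']
      exact ih.iteration hloop hcirc hord _ _
  -- The shift by one skips the initial state, where tokens may still be travelling; afterwards
  -- perceived and actual weights agree.
  obtain ⟨τ, hτ⟩ : ∃ τ : ℕ → State G, ∀ n, τ n = (cleanIteration l u ord)^[n + 1] σ :=
    ⟨_, fun _ => rfl⟩
  have hsucc : ∀ n, τ (n + 1) = cleanIteration l u ord (τ n) := by
    intro n
    rw [hτ, hτ, Function.iterate_succ_apply']
  have hv : ∀ n, (τ n).Valid l u := fun n => hτ n ▸ hvalid (n + 1)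
  have hp : ∀ n, (τ n).perceived = (τ n).weight := by
    intro n
    rw [hτ, Function.iterate_succ_apply']
    exact cleanIteration_perceived _
  have htot : ∀ n, (τ n).totalDeficit = σ.totalDeficit := by
    have h : ∀ n, ((cleanIteration l u ord)^[n] σ).totalDeficit ≤ σ.totalDeficit := by
      intro n
      induction n with
      | zero => exact le_rfl
      | succ n ih =>
        rw [Function.iterate_succ_apply']
        exact (totalDeficit_iteration_le hloop hcirc hord (hvalid n) _ _).trans ih
    exact fun n => hτ n ▸ le_antisymm (h _) (hcon _)
  have hdef : ∀ n j, (τ (n + 1)).deficit j = (τ n).deficit j := by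
    intro n j
    refine (Finset.sum_eq_sum_iff_of_le fun j _ => ?_).1 ((htot (n + 1)).trans (htot n).symm) j
      (Finset.mem_univ j)
    rw [hsucc]
    exact deficit_iteration_le hloop hcirc hord (hv n) _ _ j
  have hdef' : ∀ n m j, (τ n).deficit j = (τ m).deficit j := by
    have : ∀ n j, (τ n).deficit j = (τ 0).deficit j := by
      intro n j
      induction n with
      | zero => rfl
      | succ n ih => exact (hdef n j).trans ih
    exact fun n m j => (this n j).trans (this m j).symm
  obtain ⟨S, hS⟩ : ∃ S : Finset V, ∀ j, j ∈ S ↔ ∃ᶠ n in atTop, 0 < (τ n).perceivedImbalance j :=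
    ⟨Finset.univ.filter fun j => ∃ᶠ n in atTop, 0 < (τ n).perceivedImbalance j, by simp⟩
  obtain ⟨T, hT⟩ : ∃ T, ∀ n ≥ T, ∀ j ∉ S, (τ n).perceivedImbalance j ≤ 0 := by
    refine eventually_atTop.1 (eventually_all.2 fun j => ?_)
    by_cases hj : j ∈ S
    · exact Eventually.of_forall fun n h => absurd hj h
    · have := not_frequently.1 fun h => hj ((hS j).2 h)
      exact this.mono fun n hn _ => not_lt.1 hn
  have hstill : ∀ j ∉ S, ∀ e ∈ incident G j, ∀ n ≥ T,
      desired l u ord (τ n) e.head e = (τ n).weight e ∧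
        desired l u ord (τ n) e.tail e = (τ n).weight e := by
    intro j hj e he n hn
    refine desired_of_perceivedImbalance_eq hloop hcirc hord (hv n) (hp n) (hT n hn j hj) ?_ he
    have h1 := hT n hn j hj
    have h2 := hT (n + 1) (by omega) j hj
    have h3 := hdef n j
    unfold State.deficit at h3
    rw [← hsucc]
    omega
  have hconst : ∀ j ∉ S, ∀ e ∈ incident G j, ∀ n ≥ T, (τ n).weight e = (τ T).weight e := by
    intro j hj e he n hn
    induction n, hn using Nat.le_induction with
    | base => rfl
    | succ n hn ih =>
      have := hstill j hj e he n hn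
      rw [hsucc, cleanIteration_weight, this.1, this.2, ih]
      ring
  have hview : ∀ n j, (τ n).view j = (τ n).weight := by
    intro n j
    funext e
    simp [State.view, hp]
  -- A boundary edge with room left would never be used, as its weight is frozen. Yet the pointer of
  -- `j` would approach it at each of infinitely many activations and never move otherwise.
  have hsat : ∀ j ∈ S, ∀ i ∉ S, ∀ e ∈ incident G j, e ∈ incident G i →
      residual l u j (τ T).weight e = 0 := by
    intro j hj i hi e hej hei
    by_contra hne
    have hpos : 0 < residual l u j (τ T).weight e := by
      have := ((hv T).feasible_view j).residual_nonneg j e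
      rw [hview] at this
      omega
    have hres : ∀ n ≥ T, residual l u j ((τ n).view j) e = residual l u j (τ T).weight e := by
      intro n hn
      simp only [residual, hview, hconst i hi e hei n hn]
    have hstep : ∀ n ≥ T, 0 < (τ n).perceivedImbalance j →
        cyclicDist (totalDegree G j) (ord j e) ((τ (n + 1)).next j) <
          cyclicDist (totalDegree G j) (ord j e) ((τ n).next j) := by
      intro n hn hx
      rw [hsucc]
      refine cyclicDist_select_lt hloop hcirc hord (hv n) (by rwa [hres n hn]) hx ?_
      have h := desired_of_incident hej (hstill i hi e hei n hn)
      unfold desired at h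
      simp only [residual, hview, h]
    refine not_frequently_lt_of_eventually_le
      (d := fun n => cyclicDist (totalDegree G j) (ord j e) ((τ n).next j)) (T := T) ?_ ?_
    · intro n hn
      rcases lt_or_ge 0 ((τ n).perceivedImbalance j) with hx | hx
      · exact (hstep n hn hx).le
      · have : (τ (n + 1)).next j = (τ n).next j := by
          rw [hsucc]
          change (select l u ord (τ n) j).2 = _
          rw [select_of_nonpos hx]
        simp only [this, le_refl]
    · exact (((hS j).1 hj).and_eventually (eventually_ge_atTop T)).mono fun n hn =>
        hstep n hn.2 hn.1
  -- A node of `S` is positive at some time, where its deficit is zero; deficits are constant.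
  have hnn : ∀ j ∈ S, 0 ≤ (τ T).perceivedImbalance j := by
    intro j hj
    obtain ⟨n, hn⟩ := ((hS j).1 hj).exists
    have := hdef' n T j
    unfold State.deficit at this
    omega
  have hle : ∑ j ∈ S, (τ T).perceivedImbalance j ≤ 0 := by
    simp only [perceivedImbalance_eq_imbalance (hp T)]
    rw [sum_imbalance_eq_cut]
    have h1 : ∑ e : Edge G with e.head ∈ S ∧ e.tail ∉ S, (τ T).weight e =
        ∑ e : Edge G with e.head ∈ S ∧ e.tail ∉ S, ⌈l e⌉ := by
      refine Finset.sum_congr rfl fun e he => ?_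
      have he := (Finset.mem_filter.1 he).2
      have := hsat _ he.1 _ he.2 e (Or.inl rfl) (Or.inr rfl)
      simp only [residual, if_true, if_neg (head_ne_tail hloop e).symm] at this
      omega
    have h2 : ∑ e : Edge G with e.tail ∈ S ∧ e.head ∉ S, (τ T).weight e =
        ∑ e : Edge G with e.tail ∈ S ∧ e.head ∉ S, ⌊u e⌋ := by
      refine Finset.sum_congr rfl fun e he => ?_
      have he := (Finset.mem_filter.1 he).2
      have := hsat _ he.1 _ he.2 e (Or.inr rfl) (Or.inl rfl)
      simp only [residual, if_true] at this
      omega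
    have := hcirc.cut S
    omega
  have hzero : ∀ j, (τ T).perceivedImbalance j ≤ 0 := by
    intro j
    by_cases hj : j ∈ S
    · exact (Finset.single_le_sum hnn hj).trans hle
    · exact hT T le_rfl j hj
  have hsum := sum_perceivedImbalance (τ T)
  simp only [hp, sub_self, Finset.sum_const_zero] at hsum
  -- No tokens travel, so the nonpositive imbalances sum to zero.
  have hall := (Finset.sum_eq_zero_iff_of_nonpos fun j _ => hzero j).1 hsum
  refine h0 ((htot T).symm.trans (Finset.sum_eq_zero fun j hj => ?_))
  rw [State.deficit, hall j hj]
  rfl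

/-! ### A uniform number of iterations -/

theorem finite_valid (l u : Edge G → ℝ) : {σ : State G | σ.Valid l u}.Finite := by
  have hinj : Set.InjOn (fun σ : State G => (σ.weight, σ.perceived, σ.next))
      {σ : State G | σ.Valid l u} := by
    rintro ⟨w, p, n⟩ - ⟨w', p', n'⟩ - h
    simpa using h
  refine Set.Finite.of_finite_image (Set.Finite.subset ((Set.Finite.pi' fun e =>
    Set.finite_Icc ⌈l e⌉ ⌊u e⌋).prod ((Set.Finite.pi' fun e => Set.finite_Icc ⌈l e⌉ ⌊u e⌋).prod
      (Set.Finite.pi' fun j => Set.finite_Iio (max 1 (totalDegree G j))))) ?_) hinj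
  rintro _ ⟨σ, hσ, rfl⟩
  replace hσ : σ.Valid l u := hσ
  refine ⟨fun e => ⟨(hσ.lower e).trans (hσ.perceived_le e), hσ.upper e⟩,
    fun e => ⟨hσ.lower e, (hσ.perceived_le e).trans (hσ.upper e)⟩, hσ.next_lt⟩

theorem exists_uniform_totalDeficit_iterate_lt (hloop : ∀ v, ¬ G.Adj v v)
    (hcirc : IntegerCirculationConditions l u) (hord : IsEdgeOrder ord) :
    ∃ K, ∀ σ : State G, σ.Valid l u → σ.totalDeficit ≠ 0 →
      ∃ n ≤ K, ((cleanIteration l u ord)^[n] σ).totalDeficit < σ.totalDeficit := by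
  have h : ∀ σ : State G, ∃ n, σ.Valid l u → σ.totalDeficit ≠ 0 →
      ((cleanIteration l u ord)^[n] σ).totalDeficit < σ.totalDeficit := by
    intro σ
    by_cases hσ : σ.Valid l u ∧ σ.totalDeficit ≠ 0
    · obtain ⟨n, hn⟩ := exists_totalDeficit_iterate_lt hloop hcirc hord hσ.1 hσ.2
      exact ⟨n, fun _ _ => hn⟩
    · exact ⟨0, fun h1 h2 => absurd ⟨h1, h2⟩ hσ⟩
  choose n hn using h
  obtain ⟨K, hK⟩ := ((finite_valid l u).image n).bddAbove
  exact ⟨K, fun σ h1 h2 => ⟨n σ, hK ⟨σ, h1, rfl⟩, hn σ h1 h2⟩⟩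

/-! ### Runs -/

theorem valid_run (hloop : ∀ v, ¬ G.Adj v v)
    (hcirc : IntegerCirculationConditions l u) (hord : IsEdgeOrder ord)
    (s t : ℕ → ℕ) (x : ℕ → V → V → Bool) (k : ℕ) : (run l u ord s t x k).Valid l u := by
  induction k with
  | zero => exact ⟨fun e => le_rfl, fun e => le_rfl, hcirc.interval, fun j => by
      simp [run, initialState]⟩
  | succ k ih => exact ih.iteration hloop hcirc hord _ _

theorem totalDeficit_run_antitone (hloop : ∀ v, ¬ G.Adj v v)
    (hcirc : IntegerCirculationConditions l u) (hord : IsEdgeOrder ord)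
    (s t : ℕ → ℕ) (x : ℕ → V → V → Bool) :
    Antitone fun k => (run l u ord s t x k).totalDeficit :=
  antitone_nat_of_succ_le fun k =>
    totalDeficit_iteration_le hloop hcirc hord (valid_run hloop hcirc hord s t x k) _ _

theorem run_add_eq_iterate {s t : ℕ → ℕ} {x : ℕ → V → V → Bool} {k n : ℕ}
    (h : ∀ i < n, ∀ c : Link G, x (s (k + i)) c.1.1 c.1.2 = true ∧
      x (t (k + i)) c.1.1 c.1.2 = true) :
    run l u ord s t x (k + n) = (cleanIteration l u ord)^[n] (run l u ord s t x k) := by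
  induction n with
  | zero => rfl
  | succ n ih =>
    rw [Function.iterate_succ_apply', ← ih fun i hi => h i (by omega)]
    change iteration l u ord _ _ _ = iteration l u ord _ _ _
    congr 1
    · funext e
      exact (h n (by omega) ⟨(e.tail, e.head), Or.inl e.2⟩).1
    · funext e
      exact (h n (by omega) ⟨(e.head, e.tail), Or.inr e.2⟩).2

theorem run_eq_of_balanced {s t : ℕ → ℕ} {x : ℕ → V → V → Bool} {k₀ : ℕ}
    (h : (run l u ord s t x k₀).Balanced) {k : ℕ} (hk : k₀ ≤ k) :
    run l u ord s t x k = run l u ord s t x k₀ := by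
  induction k, hk using Nat.le_induction with
  | base => rfl
  | succ k _ ih =>
    rw [run, ih]
    exact h.iteration _ _

/-- If sufficiently long blocks without packet drops recur, then a balanced state is reached. -/
theorem exists_balanced_run (hloop : ∀ v, ¬ G.Adj v v)
    (hcirc : IntegerCirculationConditions l u) (hord : IsEdgeOrder ord) {K : ℕ}
    (hK : ∀ σ : State G, σ.Valid l u → σ.totalDeficit ≠ 0 →
      ∃ n ≤ K, ((cleanIteration l u ord)^[n] σ).totalDeficit < σ.totalDeficit)
    {s t : ℕ → ℕ} {x : ℕ → V → V → Bool}
    (hx : ∃ᶠ m in atTop, ∀ i < K + 1, ∀ c : Link G,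
      x (s (m * (K + 1) + i)) c.1.1 c.1.2 = true ∧ x (t (m * (K + 1) + i)) c.1.1 c.1.2 = true) :
    ∃ k₀, (run l u ord s t x k₀).Balanced := by
  have hv := valid_run hloop hcirc hord s t x
  have hanti := totalDeficit_run_antitone hloop hcirc hord s t x
  suffices h : ∃ k, (run l u ord s t x k).totalDeficit = 0 from
    h.imp fun k hk => (hv k).balanced_of_totalDeficit_eq_zero hk
  by_contra! h
  have hdesc : ∀ b k, (run l u ord s t x k).totalDeficit ≠ b := by
    intro b
    induction b using Nat.strong_induction_on with
    | _ b ih =>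
      intro k hb
      obtain ⟨m, hm, hgood⟩ := (frequently_atTop.1 hx) k
      obtain ⟨n, hn, hlt⟩ := hK _ (hv (m * (K + 1))) (h _)
      rw [← run_add_eq_iterate fun i hi => hgood i (by omega)] at hlt
      -- Blocks of length `K + 1` rather than `K` are nonempty even if `K = 0`, so block `m` starts
      -- no earlier than `m`.
      have hle : k ≤ m * (K + 1) := hm.trans (Nat.le_mul_of_pos_right m (by omega))
      have := hanti hle
      dsimp only at this
      exact ih _ (by omega) (m * (K + 1) + n) rfl
  exact hdesc _ 0 rfl

/-! ### Recurrence of blocks without packet drops -/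

/-- Disjoint index sets give independent events of probability at least `δ ^ c`, so their
probabilities have infinite sum and the second Borel–Cantelli lemma applies. -/
theorem ae_frequently_forall_eq_true {Ω ι : Type*} [MeasurableSpace Ω] {P : Measure Ω}
    [IsProbabilityMeasure P] {X : ι → Ω → Bool} (hX : ∀ i, Measurable (X i))
    (hind : iIndepFun X P) {δ : ENNReal} (hδ0 : δ ≠ 0) (hδ1 : δ ≤ 1)
    (hδ : ∀ i, δ ≤ P (X i ⁻¹' {true})) {I : ℕ → Finset ι}
    (hdisj : Pairwise fun m n => Disjoint (I m) (I n)) {c : ℕ} (hc : ∀ m, (I m).card ≤ c) :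
    ∀ᵐ ω ∂P, ∃ᶠ m in atTop, ∀ i ∈ I m, X i ω = true := by
  classical
  set A : ℕ → Set Ω := fun m => ⋂ i ∈ I m, X i ⁻¹' {true} with hA
  have hprod : ∀ J : Finset ι, P (⋂ i ∈ J, X i ⁻¹' {true}) = ∏ i ∈ J, P (X i ⁻¹' {true}) :=
    fun J => hind.measure_inter_preimage_eq_mul J fun i _ => measurableSet_singleton true
  have hmeas : ∀ m, MeasurableSet (A m) := fun m =>
    Finset.measurableSet_biInter _ fun i _ => hX i (measurableSet_singleton true)
  have hindep : iIndepSet A P := by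
    refine (iIndepSet_iff_meas_biInter hmeas).2 fun M => ?_
    have h1 : ⋂ m ∈ M, A m = ⋂ i ∈ M.biUnion I, X i ⁻¹' {true} := by
      ext ω
      simp only [hA, Set.mem_iInter, Finset.mem_biUnion]
      exact ⟨fun h i ⟨m, hm, hi⟩ => h m hm i hi, fun h m hm i hi => h i ⟨m, hm, hi⟩⟩
    rw [h1, hprod, Finset.prod_biUnion fun m _ n _ hmn => hdisj hmn]
    exact Finset.prod_congr rfl fun m _ => (hprod (I m)).symm
  have hlow : ∀ m, δ ^ c ≤ P (A m) := by
    intro m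
    rw [hprod]
    calc δ ^ c ≤ δ ^ (I m).card := pow_le_pow_right_of_le_one' hδ1 (hc m)
      _ = ∏ i ∈ I m, δ := by simp
      _ ≤ _ := Finset.prod_le_prod' fun i _ => hδ i
  have hsum : ∑' m, P (A m) = ⊤ := by
    refine top_le_iff.1 ?_
    rw [← ENNReal.tsum_const_eq_top_of_ne_zero (α := ℕ) (pow_ne_zero c hδ0)]
    exact ENNReal.tsum_le_tsum hlow
  have hlim := (mem_ae_iff_prob_eq_one (MeasurableSet.measurableSet_limsup hmeas)).2
    (measure_limsup_eq_one hmeas hindep hsum)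
  filter_upwards [hlim] with ω hω
  exact ((mem_limsup_iff_frequently_mem).1 hω).mono fun m hm i hi => by
    simpa using Set.mem_iInter₂.1 hm i hi

/-- There are finitely many links, and the drop probability of a link does not depend on time. -/
theorem IsPacketDropModel.exists_le_prob_true {q : V → V → ℝ}
    (hq : ∀ i j, G.Adj i j ∨ G.Adj j i → q j i < 1) {Ω : Type*} [MeasurableSpace Ω]
    {P : Measure Ω} [IsProbabilityMeasure P] {x : ℕ → V → V → Ω → Bool}
    (hx : IsPacketDropModel G q P x) :
    ∃ δ : ENNReal, δ ≠ 0 ∧ δ ≤ 1 ∧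
      ∀ (τ : ℕ) (c : Link G), δ ≤ P (x τ c.1.1 c.1.2 ⁻¹' {true}) := by
  obtain ⟨r, hr, hr0, hr1⟩ : ∃ r : ℝ, (∀ c : Link G, r ≤ 1 - q c.1.1 c.1.2) ∧ 0 < r ∧ r ≤ 1 := by
    have h1 : ∀ᶠ r : ℝ in nhdsWithin 0 (Set.Ioi 0), ∀ c : Link G, r ≤ 1 - q c.1.1 c.1.2 := by
      refine eventually_all.2 fun c => ?_
      have : 0 < 1 - q c.1.1 c.1.2 := sub_pos.2 (hq _ _ c.2.symm)
      filter_upwards [Ioc_mem_nhdsGT this] with r hr using hr.2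
    have h2 : ∀ᶠ r : ℝ in nhdsWithin 0 (Set.Ioi 0), 0 < r ∧ r ≤ 1 :=
      Ioc_mem_nhdsGT one_pos
    exact (h1.and h2).exists
  refine ⟨ENNReal.ofReal r, by simpa using hr0, by simpa using hr1, fun τ c => ?_⟩
  have hset : x τ c.1.1 c.1.2 ⁻¹' {true} = {ω | x τ c.1.1 c.1.2 ω = false}ᶜ := by
    ext ω
    simp
  have hm : MeasurableSet {ω | x τ c.1.1 c.1.2 ω = false} :=
    hx.measurable τ c (measurableSet_singleton false)
  rw [hset, ENNReal.ofReal_le_iff_le_toReal (measure_ne_top _ _)]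
  change r ≤ P.real _
  rw [probReal_compl_eq_one_sub hm, hx.prob]
  exact hr c

theorem ae_frequently_block {q : V → V → ℝ}
    (hq : ∀ i j, G.Adj i j ∨ G.Adj j i → q j i < 1) {Ω : Type*} [MeasurableSpace Ω]
    {P : Measure Ω} [IsProbabilityMeasure P] {x : ℕ → V → V → Ω → Bool}
    (hx : IsPacketDropModel G q P x) {s t : ℕ → ℕ} (hst : ∀ k, s k ≤ t k)
    (hts : ∀ k, t k < s (k + 1)) (L : ℕ) :
    ∀ᵐ ω ∂P, ∃ᶠ m in atTop, ∀ i < L, ∀ c : Link G,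
      x (s (m * L + i)) c.1.1 c.1.2 ω = true ∧ x (t (m * L + i)) c.1.1 c.1.2 ω = true := by
  classical
  obtain ⟨δ, hδ0, hδ1, hδ⟩ := hx.exists_le_prob_true hq
  have hlt : ∀ k k', k < k' → t k < s k' := by
    intro k k' hk
    induction k', hk using Nat.le_induction with
    | base => exact hts k
    | succ n _ ih => exact (ih.trans_le (hst n)).trans (hts n)
  -- As a set of time steps, `J m` counts a coincidence `s k = t k` once, so independence is not
  -- applied twice to one transmission.
  set J : ℕ → Finset ℕ := fun m =>
    (Finset.range L).biUnion fun i => {s (m * L + i), t (m * L + i)} with hJ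
  have hJlt : ∀ m n, m < n → ∀ a ∈ J m, ∀ b ∈ J n, a < b := by
    intro m n hmn a ha b hb
    simp only [hJ, Finset.mem_biUnion, Finset.mem_range, Finset.mem_insert,
      Finset.mem_singleton] at ha hb
    obtain ⟨i, hi, ha⟩ := ha
    obtain ⟨i', -, hb⟩ := hb
    have h1 : (m + 1) * L ≤ n * L := Nat.mul_le_mul_right L hmn
    have h2 := hlt (m * L + i) (n * L + i') (by rw [add_mul] at h1; omega)
    have h3 := hst (m * L + i)
    have h4 := hst (n * L + i')
    omega
  have hJcard : ∀ m, (J m).card ≤ L * 2 := by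
    intro m
    refine (Finset.card_biUnion_le_card_mul _ _ 2 fun i _ => Finset.card_le_two).trans ?_
    rw [Finset.card_range]
  have hJdisj : ∀ m n, m < n → Disjoint (J m) (J n) := fun m n hmn =>
    Finset.disjoint_left.2 fun a ha hb => (hJlt m n hmn a ha a hb).false
  have key := ae_frequently_forall_eq_true (P := P)
    (X := fun p : ℕ × Link G => x p.1 p.2.1.1 p.2.1.2) (fun p => hx.measurable p.1 p.2)
    hx.indep hδ0 hδ1 (fun p => hδ p.1 p.2) (I := fun m => J m ×ˢ Finset.univ)
    (c := L * 2 * Fintype.card (Link G)) ?_ ?_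
  · filter_upwards [key] with ω hω
    refine hω.mono fun m hm i hi c => ?_
    have hmem : ∀ τ ∈ ({s (m * L + i), t (m * L + i)} : Finset ℕ), x τ c.1.1 c.1.2 ω = true :=
      fun τ hτ => hm (τ, c) (Finset.mem_product.2
        ⟨Finset.mem_biUnion.2 ⟨i, Finset.mem_range.2 hi, hτ⟩, Finset.mem_univ c⟩)
    exact ⟨hmem _ (by simp), hmem _ (by simp)⟩
  · intro m n hmn
    refine Finset.disjoint_product.2 (Or.inl ?_)
    rcases lt_or_gt_of_ne hmn with h | h
    · exact hJdisj m n h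
    · exact (hJdisj n m h).symm
  · intro m
    rw [Finset.card_product, Finset.card_univ]
    exact Nat.mul_le_mul_right _ (hJcard m)

end WeightBalancing

theorem mainTheorem3 {V : Type*} [Fintype V] [DecidableEq V]
    (G : Digraph V) [DecidableRel G.Adj]
    (hloop : ∀ v, ¬ G.Adj v v) (hconn : WeightBalancing.StronglyConnected G)
    (l u : WeightBalancing.Edge G → ℝ) (hl : ∀ e, 0 < l e) (hlu : ∀ e, l e ≤ u e)
    (hcirc : WeightBalancing.IntegerCirculationConditions l u)
    (ord : V → WeightBalancing.Edge G → ℕ) (hord : WeightBalancing.IsEdgeOrder ord)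
    -- the time steps of the two rounds of transmissions of each iteration
    (s t : ℕ → ℕ) (hst : ∀ k, s k ≤ t k) (hts : ∀ k, t k < s (k + 1))
    (q : V → V → ℝ) (hq : ∀ i j, G.Adj i j ∨ G.Adj j i → q j i < 1)
    {Ω : Type*} [MeasurableSpace Ω] (P : MeasureTheory.Measure Ω)
    [MeasureTheory.IsProbabilityMeasure P]
    (x : ℕ → V → V → Ω → Bool) (hx : WeightBalancing.IsPacketDropModel G q P x) :
    ∀ᵐ ω ∂P,
      let σ := WeightBalancing.run l u ord s t (fun τ j i => x τ j i ω)
      ∃ k₀ : ℕ, ∀ k ≥ k₀,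
        (∀ e, (σ k).weight e = (σ k₀).weight e) ∧
        (∀ e, l e ≤ (σ k).weight e ∧ (σ k).weight e ≤ u e) ∧
        (∀ v, WeightBalancing.imbalance (σ k).weight v = 0) ∧
        (∀ v, WeightBalancing.inWeight (σ k).perceived v =
          WeightBalancing.inWeight (σ k).weight v) := by
  obtain ⟨K, hK⟩ :=
    WeightBalancing.exists_uniform_totalDeficit_iterate_lt hloop hcirc hord
  filter_upwards [WeightBalancing.ae_frequently_block hq hx hst hts (K + 1)] with ω hω
  intro σ
  obtain ⟨k₀, hk₀⟩ := WeightBalancing.exists_balanced_run hloop hcirc hord hK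
    (x := fun τ j i => x τ j i ω) hω
  refine ⟨k₀, fun k hk => ?_⟩
  have hσ : σ k = σ k₀ := WeightBalancing.run_eq_of_balanced hk₀ hk
  have hv : (σ k₀).Valid l u :=
    WeightBalancing.valid_run hloop hcirc hord s t (fun τ j i => x τ j i ω) k₀
  rw [hσ]
  exact ⟨fun e => rfl,
    fun e => ⟨Int.ceil_le.1 ((hv.lower e).trans (hv.perceived_le e)), Int.le_floor.1 (hv.upper e)⟩,
    hk₀.2, fun v => by rw [hk₀.1]⟩
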